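/- Let $C([0,1])$ carry the topology of uniform convergence and its Borel $\sigma$-field, let $\mathbb P_{\rm Bm}$ be the law on $C([0,1])$ of a standard Brownian motion, and for $\mu_1,\mu_2\in\mathbb R$ let $\mathbb P_{\rm Bm}^{\mu_1,\mu_2}$ be the law on $C([0,1])^2$ of two independent Brownian motions with drifts $\mu_1$ and $\mu_2$ (a Brownian motion with drift $\mu$ is $(\mathbb B_t+\mu t)_t$ with $\mathbb B$ a standard Brownian motion). For $\mathsf a,\mathsf c\in\mathbb R$ let $\eta^{(\mathsf a,\mathsf c)}$ be a process with law $\mathbb P_{\eta^{(\mathsf a,\mathsf c)}}$ on $C([0,1])$ given by $$\frac{d\mathbb P_{\eta^{(\mathsf a,\mathsf c)}}}{d\mathbb P_{\rm Bm}}(\omega)=\frac{e^{(\mathsf a+\mathsf c)\min_{t\in[0,1]}\omega_t-\mathsf a\,\omega_1}}{\mathbb E_{\rm Bm}\big[e^{(\mathsf a+\mathsf c)\min_{t\in[0,1]}\omega_t-\mathsf a\,\omega_1}\big]},$$ and let $\mathbb P_{\rm TL}^{\mathsf a,\mathsf c}$ be the measure on $C([0,1])^2$ given by $$\frac{d\mathbb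 P_{\rm TL}^{\mathsf a,\mathsf c}}{d\mathbb P_{\rm Bm}^{-\mathsf a,\mathsf a}}(\omega^{1},\omega^{2})=\frac1{\mathcal Z_{\mathsf a,\mathsf c}}\,e^{(\mathsf a+\mathsf c)\min_{t\in[0,1]}(\omega^{1}_t-\omega^{2}_t)},\qquad \mathcal Z_{\mathsf a,\mathsf c}=\mathbb E_{\rm Bm}^{-\mathsf a,\mathsf a}\big[e^{(\mathsf a+\mathsf c)\min_{t\in[0,1]}(\omega^{1}_t-\omega^{2}_t)}\big].$$ Then for all $\mathsf a,\mathsf c\in\mathbb R$ both normalizing constants are finite and positive, so that both are probability measures, and $\mathbb P_{\rm TL}^{\mathsf a,\mathsf c}$ is the law of the pair of processes $$\Big(\tfrac1{\sqrt2}\big(\eta^{(\sqrt2\mathsf a,\sqrt2\mathsf c)}_t+\mathbb B_t\big)_{t\in[0,1]},\ \tfrac1{\sqrt2}\big(\mathbb B_t-\eta^{(\sqrt2\mathsf a,\sqrt2\mathsf c)}_t\big)_{t\in[0,1]}\Big),$$ where $\mathbb B$ is a standard Brownian motion independent of $\eta^{(\sqrt2\mathsf a,\sqrt2\mathsf c)}$.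 In particular, the law of the process $\tfrac1{\sqrt2}\big(\mathbb B_t+\eta^{(\mathsf a/\sqrt2,\mathsf c/\sqrt2)}_t\big)_{t\in[0,1]}$, with $\mathbb B$ a standard Brownian motion independent of $\eta^{(\mathsf a/\sqrt2,\mathsf c/\sqrt2)}$, is the marginal distribution of $\mathbb P_{\rm TL}^{\mathsf a/2,\mathsf c/2}$ on the first line. -/

import Mathlib

open MeasureTheory ProbabilityTheory
open scoped NNReal unitInterval

noncomputable section

namespace TwoLine

/-- The path space `C([0,1])`, with the topology of uniform convergence. -/
abbrev PathSpace : Type := C(I, ℝ)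

instance : MeasurableSpace PathSpace := borel PathSpace

instance : BorelSpace PathSpace := ⟨rfl⟩

/-- `W` is the law on `C([0,1])` of a standard Brownian motion: at all finitely many times in
`[0,1]`, the coordinates have the finite-dimensional law of Brownian motion, that is (see
`ProbabilityTheory.BrownianReal.projectiveFamily`) the centered Gaussian law with covariance
`min s t`. A Borel measure on `C([0,1])` is determined by these laws, so there is exactly one
such `W`. -/
def IsBrownianLaw (W : Measure PathSpace) : Prop :=
  ∀ (J : Finset ℝ≥0) (hJ : ∀ t ∈ J, t ≤ 1),
    HasLaw (fun (ω : PathSpace) (t : J) ↦ ω ⟨(t : ℝ≥0), t.1.2, hJ t.1 t.2⟩)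
      (BrownianReal.projectiveFamily J) W

/-- The deterministic path `t ↦ t`. -/
def idPath : PathSpace := ⟨fun t ↦ (t : ℝ), continuous_subtype_val⟩

/-- The law on `C([0,1])` of Brownian motion with drift `μ`, the process `𝔹_t + μ t`, where `W` is
the law of a standard Brownian motion `𝔹`. -/
def driftedLaw (W : Measure PathSpace) (μ : ℝ) : Measure PathSpace :=
  W.map (fun ω ↦ ω + μ • idPath)

/-- The law on `C([0,1])²` of two independent Brownian motions with drifts `μ₁` and `μ₂`. -/
def driftedPairLaw (W : Measure PathSpace) (μ₁ μ₂ : ℝ) : Measure (PathSpace × PathSpace) :=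
  (driftedLaw W μ₁).prod (driftedLaw W μ₂)

/-- The minimum of a path over `[0,1]` (attained, as `[0,1]` is compact). -/
def pathMin (ω : PathSpace) : ℝ := ⨅ t : I, ω t

/-- The unnormalized density `exp ((a + c) min_t ω_t - a ω_1)`. -/
def etaWeight (a c : ℝ) (ω : PathSpace) : ℝ :=
  Real.exp ((a + c) * pathMin ω - a * ω 1)

/-- The law of the process `η^(a,c)`: the measure on `C([0,1])` whose density with respect to the
law `W` of standard Brownian motion is `etaWeight a c`, normalized by its expectation. -/
def etaLaw (W : Measure PathSpace) (a c : ℝ) : Measure PathSpace :=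
  W.withDensity fun ω ↦ ENNReal.ofReal (etaWeight a c ω / ∫ ω', etaWeight a c ω' ∂W)

/-- The unnormalized density `exp ((a + c) min_t (ω¹_t - ω²_t))`. -/
def twoLineWeight (a c : ℝ) (ω : PathSpace × PathSpace) : ℝ :=
  Real.exp ((a + c) * pathMin (ω.1 - ω.2))

/-- The normalizing constant of the two-line measure. -/
def twoLineConst (W : Measure PathSpace) (a c : ℝ) : ℝ :=
  ∫ ω, twoLineWeight a c ω ∂(driftedPairLaw W (-a) a)

/-- The two-line measure on `C([0,1])²`: its density with respect to the law of two independent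
Brownian motions with drifts `-a` and `a` is `twoLineWeight a c / twoLineConst W a c`. -/
def twoLineLaw (W : Measure PathSpace) (a c : ℝ) : Measure (PathSpace × PathSpace) :=
  (driftedPairLaw W (-a) a).withDensity fun ω ↦
    ENNReal.ofReal (twoLineWeight a c ω / twoLineConst W a c)

end TwoLine

end

open Filter Topology

namespace TwoLine

/-! The law of two independent Brownian motions is invariant under `rotate`, the rotation by π/4.
This linear map sends the drift `(-√2 a, 0)` to `(-a, a)`, and the difference of the two rotated
lines is `√2 η`. In rotated coordinates the two-line density therefore involves `η` alone, and `B`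
stays an independent Brownian motion. By Cameron–Martin, the drift `-√2 a` of `η` becomes the weight
`exp (-√2 a ω_1 - a ^ 2)`. Multiplied by the two-line weight, this is `etaWeight (√2 a) (√2 c)`
times `exp (-a ^ 2)`, a constant that cancels on normalizing.

Rotation invariance, Cameron–Martin and integrability (Fernique) all rest on `W` being a centered
Gaussian measure on the Banach space `C([0,1])`, which has to be derived from its finite-dimensional
laws. -/

/-! ### Gaussianity and covariance of the Brownian law. -/

theorem tendsto_charFun_map_of_tendsto {Ω : Type*} [MeasurableSpace Ω] {P : Measure Ω}
    [IsProbabilityMeasure P] {X : ℕ → Ω → ℝ} {Y : Ω → ℝ} (hX : ∀ n, Measurable (X n))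
    (hY : Measurable Y) (h : ∀ ω, Tendsto (fun n ↦ X n ω) atTop (𝓝 (Y ω))) (t : ℝ) :
    Tendsto (fun n ↦ charFun (P.map (X n)) t) atTop (𝓝 (charFun (P.map Y) t)) := by
  have key (Z : Ω → ℝ) (hZ : Measurable Z) :
      charFun (P.map Z) t = ∫ ω, Complex.exp (t * Z ω * Complex.I) ∂P := by
    rw [charFun_apply_real, integral_map hZ.aemeasurable (by fun_prop)]
  simp_rw [key _ (hX _), key _ hY]
  refine tendsto_integral_of_dominated_convergence (fun _ ↦ 1) (fun n ↦ ?_) (by fun_prop)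
    (fun n ↦ ae_of_all _ fun ω ↦ ?_) (ae_of_all _ fun ω ↦ ?_)
  · have := hX n
    exact Measurable.aestronglyMeasurable (by fun_prop)
  · rw [← Complex.ofReal_mul, Complex.norm_exp_ofReal_mul_I]
  · have hc : Continuous fun x : ℝ ↦ Complex.exp (t * x * Complex.I) := by fun_prop
    exact (hc.tendsto _).comp (h ω)

/-- A pointwise limit of centered Gaussian variables is a centered Gaussian variable. -/
theorem exists_map_eq_gaussianReal_of_tendsto {Ω : Type*} [MeasurableSpace Ω] {P : Measure Ω}
    [IsProbabilityMeasure P] {X : ℕ → Ω → ℝ} {Y : Ω → ℝ} (hX : ∀ n, Measurable (X n))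
    (hY : Measurable Y) (h : ∀ ω, Tendsto (fun n ↦ X n ω) atTop (𝓝 (Y ω)))
    (hG : ∀ n, ∃ v : ℝ≥0, P.map (X n) = gaussianReal 0 v) :
    ∃ v : ℝ≥0, P.map Y = gaussianReal 0 v := by
  choose v hv using hG
  have : IsProbabilityMeasure (P.map Y) := Measure.isProbabilityMeasure_map hY.aemeasurable
  have hlim (t : ℝ) : Tendsto (fun n ↦ ((Real.exp (-(v n * t ^ 2 / 2)) : ℝ) : ℂ)) atTop
      (𝓝 (charFun (P.map Y) t)) := by
    refine (tendsto_charFun_map_of_tendsto hX hY h t).congr fun n ↦ ?_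
    rw [hv, charFun_gaussianReal]
    push_cast
    congr 1
    ring
  -- A characteristic function is continuous and equals 1 at 0, so it is nonzero at some `t ≠ 0`.
  -- Taking logarithms there forces the variances `v n` to converge.
  obtain ⟨t, ht, hne⟩ : ∃ t : ℝ, t ≠ 0 ∧ charFun (P.map Y) t ≠ 0 := by
    have hc : Continuous (charFun (P.map Y)) := continuous_charFun
    have h0 : ∀ᶠ t in 𝓝[≠] (0 : ℝ), charFun (P.map Y) t ≠ 0 := by
      refine (hc.continuousAt.eventually_ne ?_).filter_mono nhdsWithin_le_nhds
      simp
    obtain ⟨t, h1, h2⟩ := (h0.and self_mem_nhdsWithin).exists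
    exact ⟨t, h2, h1⟩
  have hr : Tendsto (fun n ↦ Real.exp (-(v n * t ^ 2 / 2))) atTop
      (𝓝 ‖charFun (P.map Y) t‖) := by
    refine (hlim t).norm.congr fun n ↦ ?_
    rw [Complex.norm_real, Real.norm_of_nonneg (Real.exp_pos _).le]
  have hl := (hr.log (norm_ne_zero_iff.mpr hne)).mul_const (-(2 / t ^ 2))
  have hvt : Tendsto (fun n ↦ (v n : ℝ)) atTop
      (𝓝 (Real.log ‖charFun (P.map Y) t‖ * (-(2 / t ^ 2)))) := by
    refine hl.congr fun n ↦ ?_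
    rw [Real.log_exp]
    field_simp
  have hnn := ge_of_tendsto' hvt fun n ↦ (v n).2
  obtain ⟨r, hvr⟩ : ∃ r : ℝ≥0, Tendsto (fun n ↦ (v n : ℝ)) atTop (𝓝 (r : ℝ)) :=
    ⟨⟨_, hnn⟩, hvt⟩
  refine ⟨r, Measure.ext_of_charFun ?_⟩
  ext s
  refine tendsto_nhds_unique (hlim s) ?_
  rw [charFun_gaussianReal]
  have h2 := (((hvr.mul_const (s ^ 2)).div_const 2).neg).rexp
  have h3 := (Complex.continuous_ofReal.tendsto _).comp h2
  refine (h3.congr fun n ↦ rfl).trans_eq ?_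
  congr 1
  push_cast
  congr 1
  simp

variable {W : Measure PathSpace}

theorem IsBrownianLaw.isProbabilityMeasure (hW : IsBrownianLaw W) : IsProbabilityMeasure W :=
  (hW ∅ (by simp)).isProbabilityMeasure

/-- Bernstein approximations converge uniformly to the path, and `L` of the `n`-th one is a linear
combination of finitely many path values, hence centered Gaussian. The limit is then centered
Gaussian as well. -/
theorem IsBrownianLaw.map_dual_eq_gaussianReal (hW : IsBrownianLaw W)
    (L : StrongDual ℝ PathSpace) : ∃ v : ℝ≥0, W.map L = gaussianReal 0 v := by
  have := hW.isProbabilityMeasure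
  have hm (n : ℕ) : Continuous fun ω : PathSpace ↦ bernsteinApproximation n ω := by
    unfold bernsteinApproximation
    refine continuous_finsetSum _ fun k _ ↦ ?_
    have : Continuous fun ω : PathSpace ↦ ContinuousMap.const I (ω (bernstein.z k)) :=
      ContinuousMap.continuous_const'.comp (continuous_eval_const _)
    fun_prop
  refine exists_map_eq_gaussianReal_of_tendsto
    (X := fun n ω ↦ L (bernsteinApproximation n ω)) (fun n ↦ (L.continuous.comp (hm n)).measurable)
    L.continuous.measurable
    (fun ω ↦ (L.continuous.tendsto _).comp (bernsteinApproximation_uniform ω)) fun n ↦ ?_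
  let p (k : Fin (n + 1)) : ℝ≥0 := ⟨bernstein.z k, (bernstein.z k).2.1⟩
  let J : Finset ℝ≥0 := Finset.univ.image p
  have hJ : ∀ t ∈ J, t ≤ 1 := by
    intro t ht
    obtain ⟨k, -, rfl⟩ := Finset.mem_image.mp ht
    exact (bernstein.z k).2.2
  let q (k : Fin (n + 1)) : J := ⟨p k, Finset.mem_image_of_mem _ (Finset.mem_univ _)⟩
  let A : StrongDual ℝ (J → ℝ) :=
    ∑ k : Fin (n + 1), L (bernstein n k) • ContinuousLinearMap.proj (R := ℝ) (q k)
  have hA : (fun ω : PathSpace ↦ L (bernsteinApproximation n ω)) =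
      A ∘ fun (ω : PathSpace) (t : J) ↦ ω ⟨(t : ℝ≥0), t.1.2, hJ t.1 t.2⟩ := by
    ext ω
    have h1 : bernsteinApproximation n ω =
        ∑ k : Fin (n + 1), ω (bernstein.z k) • bernstein n k := by
      ext x
      simp [bernsteinApproximation.apply, mul_comm]
    rw [h1, map_sum]
    simp only [A, Function.comp_apply, sum_apply, map_smul, smul_eq_mul,
      smul_apply, ContinuousLinearMap.proj_apply]
    exact Finset.sum_congr rfl fun k _ ↦ mul_comm _ _
  have hlaw := hW J hJ
  rw [hA, ← AEMeasurable.map_map_of_aemeasurable A.continuous.aemeasurable hlaw.aemeasurable,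
    hlaw.map_eq, IsGaussian.map_eq_gaussianReal,
    ContinuousLinearMap.integral_comp_id_comm IsGaussian.integrable_id,
    BrownianReal.integral_id_projectiveFamily, map_zero]
  exact ⟨_, rfl⟩

theorem IsBrownianLaw.isGaussian (hW : IsBrownianLaw W) : IsGaussian W :=
  isGaussian_of_map_eq_gaussianReal fun L ↦
    let ⟨v, hv⟩ := hW.map_dual_eq_gaussianReal L
    ⟨0, v, hv⟩

theorem IsBrownianLaw.integral_dual (hW : IsBrownianLaw W) (L : StrongDual ℝ PathSpace) :
    ∫ ω, L ω ∂W = 0 := by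
  obtain ⟨v, hv⟩ := hW.map_dual_eq_gaussianReal L
  have h := integral_map (μ := W) (φ := L) (f := fun x : ℝ ↦ x) L.continuous.aemeasurable
    (by fun_prop)
  rw [← h, hv, integral_id_gaussianReal]

theorem IsBrownianLaw.covariance_eval (hW : IsBrownianLaw W) (s t : I) :
    cov[fun ω ↦ ω s, fun ω ↦ ω t; W] = min (s : ℝ) t := by
  let s' : ℝ≥0 := ⟨s, s.2.1⟩
  let t' : ℝ≥0 := ⟨t, t.2.1⟩
  have hJ : ∀ r ∈ ({s', t'} : Finset ℝ≥0), r ≤ 1 := by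
    intro r hr
    rcases Finset.mem_insert.mp hr with rfl | hr
    · exact s.2.2
    · rw [Finset.mem_singleton.mp hr]; exact t.2.2
  have h := (hW _ hJ).covariance_fun_comp (f := fun x ↦ x ⟨s', by simp⟩)
    (g := fun x ↦ x ⟨t', by simp⟩) (measurable_pi_apply _).aemeasurable
    (measurable_pi_apply _).aemeasurable
  rw [BrownianReal.covariance_eval_projectiveFamily] at h
  exact h.trans (NNReal.coe_min s' t')

/-- For a Brownian law, the covariance of a functional `L` with the endpoint is `L (t ↦ t)`. -/
theorem IsBrownianLaw.covariance_dual_eval_one (hW : IsBrownianLaw W)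
    (L : StrongDual ℝ PathSpace) : cov[L, fun ω ↦ ω 1; W] = L idPath := by
  have := hW.isGaussian
  have hid : MemLp (fun ω : PathSpace ↦ ω) 2 W := IsGaussian.memLp_two_id
  have hcov (M : StrongDual ℝ PathSpace) :
      cov[M, fun ω ↦ ω 1; W] = ∫ ω, M ω * ω 1 ∂W := by
    have h1 := hW.integral_dual (ContinuousMap.evalCLM ℝ (1 : I))
    have h2 := hW.integral_dual M
    simp only [ContinuousMap.evalCLM_apply] at h1
    simp [covariance, h1, h2]
  have hint : Integrable (fun ω : PathSpace ↦ ω 1 • ω) W := by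
    have h1 : MemLp (fun ω : PathSpace ↦ ω 1) 2 W :=
      IsGaussian.memLp_dual W (ContinuousMap.evalCLM ℝ (1 : I)) 2 (by simp)
    exact memLp_one_iff_integrable.mp (hid.smul h1)
  -- Evaluated at `t`, this Bochner integral is the covariance `min t 1 = t`; every `L` then passes
  -- through the integral.
  have hid : ∫ ω : PathSpace, ω 1 • ω ∂W = idPath := by
    ext t
    have h := (ContinuousMap.evalCLM ℝ t).integral_comp_comm hint
    have h2 := hcov (ContinuousMap.evalCLM ℝ t)
    have h3 := hW.covariance_eval t 1
    simp only [ContinuousMap.evalCLM_apply, ContinuousMap.smul_apply, smul_eq_mul] at h h2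
    rw [← h]
    simp_rw [mul_comm]
    rw [← h2]
    refine h3.trans ?_
    simpa [idPath] using t.2.2
  rw [hcov, ← hid, ← L.integral_comp_comm hint]
  simp [mul_comm]

/-! ### Cameron–Martin for linear drift. -/

theorem map_withDensity_comp {α β : Type*} [MeasurableSpace α] [MeasurableSpace β]
    {μ : Measure α} {f : α → β} (hf : Measurable f) {g : β → ENNReal} (hg : Measurable g) :
    (μ.withDensity (g ∘ f)).map f = (μ.map f).withDensity g := by
  ext s hs
  rw [Measure.map_apply hf hs, withDensity_apply _ (hf hs), withDensity_apply _ hs,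
    setLIntegral_map hs hg hf]
  rfl

theorem gaussianReal_map_add_const_eq_withDensity (m : ℝ) :
    (gaussianReal 0 1).map (· + m) =
      (gaussianReal 0 1).withDensity fun x ↦ ENNReal.ofReal (Real.exp (m * x - m ^ 2 / 2)) := by
  rw [gaussianReal_map_add_const, gaussianReal_of_var_ne_zero _ one_ne_zero,
    gaussianReal_of_var_ne_zero _ one_ne_zero,
    ← withDensity_mul _ (measurable_gaussianPDF 0 1) (by fun_prop)]
  congr 1
  ext x
  rw [Pi.mul_apply, gaussianPDF, gaussianPDF,
    ← ENNReal.ofReal_mul (gaussianPDFReal_nonneg _ _ _)]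
  congr 1
  rw [gaussianPDFReal, gaussianPDFReal, mul_assoc _ (Real.exp _) (Real.exp _), ← Real.exp_add]
  congr 2
  push_cast
  ring

/-- The map sending a path to its bridge part `ω - ω_1 t`. -/
noncomputable def bridge : PathSpace →L[ℝ] PathSpace :=
  ContinuousLinearMap.id ℝ PathSpace -
    (ContinuousMap.evalCLM ℝ (1 : I)).smulRight idPath

theorem bridge_apply (ω : PathSpace) : bridge ω = ω - ω 1 • idPath := rfl

/-- Bridge and endpoint are jointly Gaussian, and the covariance of `L ∘ bridge` with the endpoint
is `L (bridge idPath) = 0`. -/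
theorem IsBrownianLaw.indepFun_bridge (hW : IsBrownianLaw W) :
    IndepFun bridge (fun ω : PathSpace ↦ ω 1) W := by
  have := hW.isGaussian
  have hlaw : HasGaussianLaw (fun ω : PathSpace ↦ (bridge ω, ω 1)) W :=
    IsGaussian.hasGaussianLaw_id.map_fun (bridge.prod (ContinuousMap.evalCLM ℝ (1 : I)))
  refine hlaw.indepFun_of_covariance_strongDual fun L M ↦ ?_
  have h1 : M ∘ (fun ω : PathSpace ↦ ω 1) = fun ω : PathSpace ↦ M 1 * ω 1 := by
    ext ω
    rw [Function.comp_apply, mul_comm, ← smul_eq_mul, ← map_smul]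
    simp
  rw [h1, covariance_const_mul_right, ← ContinuousLinearMap.coe_comp,
    hW.covariance_dual_eval_one, ContinuousLinearMap.comp_apply, bridge_apply]
  simp [idPath]

/-- The Cameron–Martin formula in the direction of the path `t ↦ t`. -/
theorem IsBrownianLaw.driftedLaw_eq_withDensity (hW : IsBrownianLaw W) (m : ℝ) :
    driftedLaw W m =
      W.withDensity fun ω ↦ ENNReal.ofReal (Real.exp (m * ω 1 - m ^ 2 / 2)) := by
  have := hW.isProbabilityMeasure
  have heval : Measurable fun ω : PathSpace ↦ ω 1 :=
    (continuous_eval_const (1 : I)).measurable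
  have hN : W.map (fun ω : PathSpace ↦ ω 1) = gaussianReal 0 1 := by
    have := hW.isGaussian
    have h := IsGaussian.map_eq_gaussianReal (μ := W) (ContinuousMap.evalCLM ℝ (1 : I))
    rw [hW.integral_dual, ← covariance_self (ContinuousLinearMap.continuous _).aemeasurable] at h
    refine h.trans ?_
    have h2 := hW.covariance_eval 1 1
    simp only [Set.Icc.coe_one, min_self] at h2
    exact (congrArg (fun r : ℝ ↦ gaussianReal 0 r.toNNReal) h2).trans (by simp)
  -- In the coordinates (bridge, endpoint) a linear drift only translates the endpoint. Independence
  -- then reduces the formula to a shift of a one-dimensional Gaussian.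
  let Φ : PathSpace × ℝ → PathSpace := fun x ↦ x.1 + x.2 • idPath
  let Ψ : PathSpace → PathSpace × ℝ := fun ω ↦ (bridge ω, ω 1)
  have hΦ : Measurable Φ := by
    have : Continuous Φ := by fun_prop
    exact this.measurable
  have hΨ : Measurable Ψ := bridge.continuous.measurable.prodMk heval
  have hΦΨ : Φ ∘ Ψ = id := by
    ext1 ω
    simp [Φ, Ψ, bridge_apply]
  have hprod : W.map Ψ = (W.map bridge).prod (gaussianReal 0 1) := by
    rw [← hN]
    exact (indepFun_iff_map_prod_eq_prod_map_map bridge.continuous.aemeasurable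
      heval.aemeasurable).mp hW.indepFun_bridge
  have : IsProbabilityMeasure (W.map bridge) :=
    Measure.isProbabilityMeasure_map bridge.continuous.aemeasurable
  let k : ℝ → ENNReal := fun x ↦ ENNReal.ofReal (Real.exp (m * x - m ^ 2 / 2))
  have hk : Measurable k := by fun_prop
  have hshift : (W.map Ψ).map (Prod.map id (· + m)) = (W.map Ψ).withDensity (k ∘ Prod.snd) := by
    rw [hprod, ← Measure.map_prod_map _ _ measurable_id (by fun_prop), Measure.map_id,
      gaussianReal_map_add_const_eq_withDensity, prod_withDensity_right hk]
    rfl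
  calc driftedLaw W m = ((W.map Ψ).map (Prod.map id (· + m))).map Φ := by
        rw [Measure.map_map hΦ (by fun_prop), Measure.map_map (hΦ.comp (by fun_prop)) hΨ,
          driftedLaw]
        congr 1
        ext1 ω
        simp only [Φ, Ψ, bridge_apply, add_smul, Function.comp_apply, Prod.map_apply, id_eq]
        abel
    _ = ((W.withDensity (k ∘ Prod.snd ∘ Ψ)).map Ψ).map Φ := by
        rw [hshift, ← map_withDensity_comp hΨ (hk.comp measurable_snd)]
        rfl
    _ = W.withDensity (k ∘ Prod.snd ∘ Ψ) := by
        rw [Measure.map_map hΦ hΨ, hΦΨ, Measure.map_id]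

/-! ### The path minimum and integrability of the weights. -/

theorem abs_pathMin_sub_le (ω ω' : PathSpace) : |pathMin ω - pathMin ω'| ≤ ‖ω - ω'‖ := by
  have key (u v : PathSpace) : pathMin u ≤ pathMin v + ‖u - v‖ := by
    rw [← sub_le_iff_le_add]
    refine le_ciInf fun t ↦ ?_
    have h1 : pathMin u ≤ u t := ciInf_le (isCompact_range u.continuous).bddBelow t
    have h2 := (le_abs_self _).trans ((u - v).norm_coe_le_norm t)
    rw [ContinuousMap.sub_apply] at h2
    linarith
  rw [abs_sub_le_iff]
  have h1 := key ω ω'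
  have h2 := key ω' ω
  rw [norm_sub_rev] at h2
  constructor <;> linarith

theorem abs_pathMin_le (ω : PathSpace) : |pathMin ω| ≤ ‖ω‖ := by
  have h := abs_pathMin_sub_le ω 0
  have h0 : pathMin 0 = 0 := by simp [pathMin]
  simpa [h0] using h

@[fun_prop]
theorem continuous_pathMin : Continuous pathMin :=
  (LipschitzWith.of_dist_le_mul (K := 1) fun ω ω' ↦ by
    rw [Real.dist_eq, dist_eq_norm, NNReal.coe_one, one_mul]
    exact abs_pathMin_sub_le ω ω').continuous

theorem pathMin_smul {r : ℝ} (hr : 0 ≤ r) (ω : PathSpace) :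
    pathMin (r • ω) = r * pathMin ω := by
  simp only [pathMin, ContinuousMap.smul_apply, smul_eq_mul]
  exact (Real.mul_iInf_of_nonneg hr _).symm

theorem continuous_etaWeight (a c : ℝ) : Continuous (etaWeight a c) := by
  have : Continuous fun ω : PathSpace ↦ ω 1 := continuous_eval_const (1 : I)
  unfold etaWeight
  fun_prop

theorem continuous_twoLineWeight (a c : ℝ) : Continuous (twoLineWeight a c) := by
  unfold twoLineWeight
  fun_prop

/-- Exponentials of linearly bounded functionals are integrable for Gaussian measures. -/
theorem integrable_exp_of_abs_le_mul_norm {E : Type*} [NormedAddCommGroup E] [NormedSpace ℝ E]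
    [MeasurableSpace E] [BorelSpace E] [CompleteSpace E] [SecondCountableTopology E]
    (μ : Measure E) [IsGaussian μ] {f : E → ℝ} (hf : Measurable f) (K : ℝ)
    (h : ∀ x, |f x| ≤ K * ‖x‖) : Integrable (fun x ↦ Real.exp (f x)) μ := by
  obtain ⟨C, hC, hint⟩ := IsGaussian.exists_integrable_exp_sq μ
  refine (hint.const_mul (Real.exp (K ^ 2 / (4 * C)))).mono' (by fun_prop)
    (ae_of_all _ fun x ↦ ?_)
  rw [Real.norm_of_nonneg (Real.exp_pos _).le, ← Real.exp_add, Real.exp_le_exp]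
  refine ((le_abs_self _).trans (h x)).trans ?_
  -- Completing the square bounds `K ‖x‖` by the Fernique exponent `C ‖x‖ ^ 2` plus a constant.
  have h1 : K ^ 2 / (4 * C) + C * ‖x‖ ^ 2 - K * ‖x‖ = (K - 2 * C * ‖x‖) ^ 2 / (4 * C) := by
    field_simp
    ring
  have h2 : 0 ≤ (K - 2 * C * ‖x‖) ^ 2 / (4 * C) := by positivity
  linarith

theorem IsBrownianLaw.integrable_etaWeight (hW : IsBrownianLaw W) (a c : ℝ) :
    Integrable (etaWeight a c) W := by
  have := hW.isGaussian
  have h1 : Continuous fun ω : PathSpace ↦ ω 1 := continuous_eval_const (1 : I)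
  refine integrable_exp_of_abs_le_mul_norm W
    (f := fun ω ↦ (a + c) * pathMin ω - a * ω 1)
    (Continuous.measurable (by fun_prop)) (|a + c| + |a|) fun ω ↦ ?_
  refine (abs_sub _ _).trans ?_
  rw [abs_mul, abs_mul, add_mul]
  gcongr
  · exact abs_pathMin_le ω
  · exact ω.norm_coe_le_norm 1

theorem IsBrownianLaw.integrable_twoLineWeight (hW : IsBrownianLaw W) (a c μ₁ μ₂ : ℝ) :
    Integrable (twoLineWeight a c) (driftedPairLaw W μ₁ μ₂) := by
  have := hW.isGaussian
  have h1 (m : ℝ) : IsGaussian (driftedLaw W m) := by unfold driftedLaw; infer_instance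
  have h2 : IsGaussian (driftedPairLaw W μ₁ μ₂) := by unfold driftedPairLaw; infer_instance
  refine integrable_exp_of_abs_le_mul_norm (driftedPairLaw W μ₁ μ₂)
    (f := fun ω ↦ (a + c) * pathMin (ω.1 - ω.2))
    (Continuous.measurable (by fun_prop)) (|a + c| * 2) fun ω ↦ ?_
  rw [abs_mul, mul_assoc]
  gcongr
  refine (abs_pathMin_le _).trans ((norm_sub_le _ _).trans ?_)
  linarith [norm_fst_le ω, norm_snd_le ω]

theorem isProbabilityMeasure_withDensity_div_integral {α : Type*} [MeasurableSpace α]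
    {μ : Measure α} {f : α → ℝ} (hf : Integrable f μ) (h0 : ∀ x, 0 ≤ f x)
    (hpos : 0 < ∫ x, f x ∂μ) :
    IsProbabilityMeasure (μ.withDensity fun x ↦ ENNReal.ofReal (f x / ∫ y, f y ∂μ)) := by
  constructor
  rw [withDensity_apply _ MeasurableSet.univ, Measure.restrict_univ,
    ← ofReal_integral_eq_lintegral_ofReal (hf.div_const _)
      (ae_of_all _ fun x ↦ div_nonneg (h0 x) hpos.le), integral_div, div_self hpos.ne',
    ENNReal.ofReal_one]

/-! ### Rotation of the two lines. -/

/-- The rotation `(η, B) ↦ ((η + B) / √2, (B - η) / √2)`. -/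
noncomputable def rotate (x : PathSpace × PathSpace) : PathSpace × PathSpace :=
  ((√2)⁻¹ • (x.1 + x.2), (√2)⁻¹ • (x.2 - x.1))

theorem continuous_rotate : Continuous rotate := by
  unfold rotate
  fun_prop

theorem IsBrownianLaw.map_rotate_prod (hW : IsBrownianLaw W) :
    (W.prod W).map rotate = W.prod W := by
  have := hW.isGaussian
  have h := IsGaussian.map_rotation_eq_self_of_forall_strongDual_eq_zero
    hW.integral_dual (Real.pi / 4)
  have hrot : rotate = ContinuousLinearMap.rotation (E := PathSpace) (Real.pi / 4) := by
    ext1 x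
    have hs : (√2)⁻¹ = √2 / 2 := by
      rw [inv_eq_iff_eq_inv, inv_div, eq_comm, div_eq_iff (by positivity)]
      exact (Real.mul_self_sqrt (by norm_num)).symm
    rw [ContinuousLinearMap.rotation_apply, rotate, Real.cos_pi_div_four, Real.sin_pi_div_four,
      hs, smul_add, smul_sub, neg_smul, neg_add_eq_sub]
  rw [hrot]
  exact h

theorem IsBrownianLaw.driftedPairLaw_eq_map_rotate (hW : IsBrownianLaw W) (a : ℝ) :
    driftedPairLaw W (-a) a = ((driftedLaw W (-(√2 * a))).prod W).map rotate := by
  have := hW.isProbabilityMeasure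
  have hs : (√2)⁻¹ * √2 = 1 := inv_mul_cancel₀ (by positivity)
  have hm (m : ℝ) : Measurable fun ω : PathSpace ↦ ω + m • idPath :=
    Continuous.measurable (by fun_prop)
  have hR := continuous_rotate.measurable
  have h1 : (driftedLaw W (-(√2 * a))).prod W =
      (W.prod W).map (Prod.map (fun ω ↦ ω + (-(√2 * a)) • idPath) id) := by
    rw [← Measure.map_prod_map _ _ (hm _) measurable_id, Measure.map_id]
    rfl
  rw [h1, driftedPairLaw, driftedLaw, driftedLaw, Measure.map_prod_map _ _ (hm _) (hm _)]
  -- Inserting the rotation on the left only turns both sides into pushforwards of `W.prod W`, so it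
  -- remains to compare the two maps.
  conv_lhs => rw [← hW.map_rotate_prod]
  rw [Measure.map_map ((hm _).prodMap (hm _)) hR,
    Measure.map_map hR ((hm _).prodMap measurable_id)]
  congr 1
  funext ⟨x, y⟩
  have h2 : (√2)⁻¹ * (√2 * a) = a := by rw [← mul_assoc, hs, one_mul]
  have h3 : ((√2)⁻¹ : ℝ) • ((√2 * a) • idPath) = a • idPath := by rw [smul_smul, h2]
  simp only [Function.comp_apply, Prod.map_apply, rotate, id_eq, neg_smul, smul_add, smul_sub,
    smul_neg, h3, Prod.mk.injEq]
  constructor <;> abel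

/-- The component `x.2` cancels in the difference of the lines, leaving `√2 • x.1`, and the minimum
is positively homogeneous. -/
theorem twoLineWeight_rotate (a c : ℝ) (x : PathSpace × PathSpace) :
    twoLineWeight a c (rotate x) = Real.exp ((√2 * a + √2 * c) * pathMin x.1) := by
  have h : (√2)⁻¹ • (x.1 + x.2) - (√2)⁻¹ • (x.2 - x.1) = √2 • x.1 := by
    have hs : (√2)⁻¹ + (√2)⁻¹ = √2 := by
      rw [← two_mul, ← div_eq_mul_inv, Real.div_sqrt]
    have h2 : x.1 + x.2 - (x.2 - x.1) = x.1 + x.1 := by abel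
    rw [← smul_sub, h2, smul_add, ← add_smul, hs]
  rw [twoLineWeight, rotate, h, pathMin_smul (Real.sqrt_nonneg 2)]
  congr 1
  ring

/-- The factor `exp (-a ^ 2)` is the Cameron–Martin correction, since `(√2 a) ^ 2 / 2 = a ^ 2`. -/
theorem exp_mul_exp_eq_etaWeight (a c : ℝ) (ω : PathSpace) :
    Real.exp (-(√2 * a) * ω 1 - (-(√2 * a)) ^ 2 / 2) *
        Real.exp ((√2 * a + √2 * c) * pathMin ω) =
      Real.exp (-a ^ 2) * etaWeight (√2 * a) (√2 * c) ω := by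
  rw [etaWeight, ← Real.exp_add, ← Real.exp_add]
  congr 1
  have hs : √2 ^ 2 = (2 : ℝ) := Real.sq_sqrt (by norm_num)
  linear_combination (-(a ^ 2) / 2) * hs

theorem IsBrownianLaw.twoLineConst_eq (hW : IsBrownianLaw W) (a c : ℝ) :
    twoLineConst W a c =
      Real.exp (-a ^ 2) * ∫ ω, etaWeight (√2 * a) (√2 * c) ω ∂W := by
  have := hW.isProbabilityMeasure
  have h1 : Continuous fun ω : PathSpace ↦ ω 1 := continuous_eval_const (1 : I)
  have h2 : Measurable fun ω : PathSpace ↦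
      ENNReal.ofReal (Real.exp (-(√2 * a) * ω 1 - (-(√2 * a)) ^ 2 / 2)) :=
    Measurable.ennreal_ofReal (Continuous.measurable (by fun_prop))
  rw [twoLineConst, hW.driftedPairLaw_eq_map_rotate, integral_map
    continuous_rotate.aemeasurable (continuous_twoLineWeight a c).aestronglyMeasurable]
  simp_rw [twoLineWeight_rotate]
  have : SFinite (driftedLaw W (-(√2 * a))) := by unfold driftedLaw; infer_instance
  rw [integral_fun_fst (fun ω ↦ Real.exp ((√2 * a + √2 * c) * pathMin ω)),
    hW.driftedLaw_eq_withDensity, integral_withDensity_eq_integral_toReal_smul h2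
      (ae_of_all _ fun _ ↦ ENNReal.ofReal_lt_top)]
  simp_rw [ENNReal.toReal_ofReal (Real.exp_pos _).le, smul_eq_mul, exp_mul_exp_eq_etaWeight,
    integral_const_mul]
  simp

/-- The two-line measure is the rotation of the product of the law of `η` and the Brownian law. -/
theorem IsBrownianLaw.map_rotate_etaLaw_prod (hW : IsBrownianLaw W) (a c : ℝ) :
    ((etaLaw W (√2 * a) (√2 * c)).prod W).map rotate = twoLineLaw W a c := by
  have := hW.isProbabilityMeasure
  have h1 : Continuous fun ω : PathSpace ↦ ω 1 := continuous_eval_const (1 : I)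
  have h2 : Measurable fun ω : PathSpace ↦
      ENNReal.ofReal (Real.exp (-(√2 * a) * ω 1 - (-(√2 * a)) ^ 2 / 2)) :=
    Measurable.ennreal_ofReal (Continuous.measurable (by fun_prop))
  have h3 : Measurable fun ω ↦
      ENNReal.ofReal (twoLineWeight a c ω / twoLineConst W a c) :=
    ((continuous_twoLineWeight a c).measurable.div_const _).ennreal_ofReal
  have h4 : Measurable fun ω ↦ ENNReal.ofReal (etaWeight (√2 * a) (√2 * c) ω /
      ∫ ω', etaWeight (√2 * a) (√2 * c) ω' ∂W) :=
    ((continuous_etaWeight _ _).measurable.div_const _).ennreal_ofReal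
  have h5 : Measurable fun x : PathSpace × PathSpace ↦
      ENNReal.ofReal (Real.exp (-(√2 * a) * x.1 1 - (-(√2 * a)) ^ 2 / 2)) :=
    h2.comp measurable_fst
  rw [twoLineLaw, hW.driftedPairLaw_eq_map_rotate,
    ← map_withDensity_comp continuous_rotate.measurable h3, hW.driftedLaw_eq_withDensity,
    etaLaw, prod_withDensity_left h4, prod_withDensity_left h2,
    ← withDensity_mul _ h5 (h3.comp continuous_rotate.measurable)]
  congr 2
  ext1 x
  rw [Pi.mul_apply, Function.comp_apply, twoLineWeight_rotate, hW.twoLineConst_eq,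
    ← ENNReal.ofReal_mul (Real.exp_pos _).le, ← mul_div_assoc, exp_mul_exp_eq_etaWeight,
    mul_div_mul_left _ _ (Real.exp_pos _).ne']

theorem IsBrownianLaw.integral_etaWeight_pos (hW : IsBrownianLaw W) (a c : ℝ) :
    0 < ∫ ω, etaWeight a c ω ∂W :=
  have := hW.isProbabilityMeasure
  integral_exp_pos (hW.integrable_etaWeight a c)

theorem IsBrownianLaw.isProbabilityMeasure_etaLaw (hW : IsBrownianLaw W) (a c : ℝ) :
    IsProbabilityMeasure (etaLaw W a c) :=
  isProbabilityMeasure_withDensity_div_integral (hW.integrable_etaWeight a c)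
    (fun _ ↦ (Real.exp_pos _).le) (hW.integral_etaWeight_pos a c)

theorem IsBrownianLaw.hasLaw_rotate (hW : IsBrownianLaw W) (a c : ℝ) {Ω : Type*}
    [MeasurableSpace Ω] {P : Measure Ω} {η B : Ω → PathSpace}
    (hη : HasLaw η (etaLaw W (√2 * a) (√2 * c)) P) (hB : HasLaw B W P) (h : IndepFun η B P) :
    HasLaw (fun x ↦ rotate (η x, B x)) (twoLineLaw W a c) P := by
  have := hW.isProbabilityMeasure
  have := hB.isProbabilityMeasure
  have hpair : HasLaw (fun x ↦ (η x, B x)) ((etaLaw W (√2 * a) (√2 * c)).prod W) P := by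
    refine ⟨hη.aemeasurable.prodMk hB.aemeasurable, ?_⟩
    rw [(indepFun_iff_map_prod_eq_prod_map_map hη.aemeasurable hB.aemeasurable).mp h,
      hη.map_eq, hB.map_eq]
  exact HasLaw.fun_comp ⟨continuous_rotate.aemeasurable, hW.map_rotate_etaLaw_prod a c⟩ hpair

end TwoLine

theorem proposition3p1 (W : Measure TwoLine.PathSpace) (hW : TwoLine.IsBrownianLaw W)
    (a c : ℝ) :
    -- the measures in the statement are well defined probability measures
    (Integrable (TwoLine.etaWeight a c) W ∧ 0 < ∫ ω, TwoLine.etaWeight a c ω ∂W ∧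
      IsProbabilityMeasure (TwoLine.etaLaw W a c)) ∧
    (Integrable (TwoLine.twoLineWeight a c) (TwoLine.driftedPairLaw W (-a) a) ∧
      0 < TwoLine.twoLineConst W a c ∧ IsProbabilityMeasure (TwoLine.twoLineLaw W a c)) ∧
    -- the two-line measure is the law of the pair
    (∀ {Ω : Type*} [MeasurableSpace Ω] (P : Measure Ω) (η B : Ω → TwoLine.PathSpace),
      HasLaw η (TwoLine.etaLaw W (√2 * a) (√2 * c)) P → HasLaw B W P → IndepFun η B P →
      HasLaw (fun x ↦ ((√2)⁻¹ • (η x + B x), (√2)⁻¹ • (B x - η x)))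
        (TwoLine.twoLineLaw W a c) P) ∧
    -- the limit process is the first-line marginal
    (∀ {Ω : Type*} [MeasurableSpace Ω] (P : Measure Ω) (η B : Ω → TwoLine.PathSpace),
      HasLaw η (TwoLine.etaLaw W (a / √2) (c / √2)) P → HasLaw B W P → IndepFun η B P →
      HasLaw (fun x ↦ (√2)⁻¹ • (B x + η x))
        (TwoLine.twoLineLaw W (a / 2) (c / 2)).fst P) := by
  refine ⟨⟨hW.integrable_etaWeight a c, hW.integral_etaWeight_pos a c,
    hW.isProbabilityMeasure_etaLaw a c⟩, ?_, fun P η B hη hB h ↦ hW.hasLaw_rotate a c hη hB h,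
    fun P η B hη hB h ↦ ?_⟩
  · have hpos : 0 < TwoLine.twoLineConst W a c := by
      rw [hW.twoLineConst_eq]
      exact mul_pos (Real.exp_pos _) (hW.integral_etaWeight_pos _ _)
    exact ⟨hW.integrable_twoLineWeight a c _ _, hpos,
      TwoLine.isProbabilityMeasure_withDensity_div_integral
        (hW.integrable_twoLineWeight a c _ _) (fun _ ↦ (Real.exp_pos _).le) hpos⟩
  -- This matches the parameters of `η` with those of the two-line measure at `a / 2`, `c / 2`.
  · have hs (r : ℝ) : r / √2 = √2 * (r / 2) := by
      rw [div_eq_iff (by positivity)]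
      linear_combination (-(r / 2)) * Real.mul_self_sqrt (show (0 : ℝ) ≤ 2 by norm_num)
    rw [hs a, hs c] at hη
    have hfst : HasLaw Prod.fst (TwoLine.twoLineLaw W (a / 2) (c / 2)).fst
        (TwoLine.twoLineLaw W (a / 2) (c / 2)) := ⟨measurable_fst.aemeasurable, rfl⟩
    have h1 := hfst.fun_comp (hW.hasLaw_rotate (a / 2) (c / 2) hη hB h)
    simpa only [TwoLine.rotate, add_comm] using h1
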